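/- A \emph{dessin} of degree $n$ is a triple $(x,y,z)$ of permutations of a finite non-empty set of $n$ edges with $xyz=1$, generating a transitive group (its monodromy group). Its type is the triple of orders of $x,y,z$. Its genus $g$ is given by $2-2g=c(x)+c(y)+c(z)-n$, where $c(\cdot)$ is the number of cycles, fixed points included. Its automorphism group is the centraliser of the monodromy group in ${\rm S}_n$; the dessin is regular if this group is transitive on the edges. For a dessin $\mathcal R$ and $H\le{\rm Aut}(\mathcal R)$, the quotient $\mathcal R/H$ is the dessin induced on the $H$-orbits of edges; the quotient is called faithful if the core of $H$ in ${\rm Aut}(\mathcal R)$ is trivial. A \emph{Hurwitz dessin} is a regular dessin of type $(3,2,7)$. Let $q=p^e$ be a power of a prime $p$ with $q$ coprime to $42$, and let $\mathcal R$ be a Hurwitz dessin with automorphism group $G\cong{\rm PSL}_2(q)$. Then $G$ has dihedral subgroups of order $q-1$, and they form a single conjugacy class. Let $H$ be any Sylow $p$-subgroup of $G$ and $H'$ any dihedral subgroup of $G$ of order $q-1$. Then $\mathcal R/H$ and $\mathcal R/H'$ are faithful quotients of $\mathcal R$, of degrees $$n=\frac{q^2-1}{2}\qquad\text{and}\qquad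 n'=\frac{q(q+1)}{2}>n,$$ while their genera $g$ and $g'$ satisfy $$g=\frac{q^2+167}{168}\qquad\text{and}\qquad g'\le\frac{q^2-20q+147}{168}<g,$$ so that $g'<g$ although $n'>n$. If $q=13$, then $n=84$, $n'=91$, $g=2$ and $g'=0$; and this case does occur, that is, there is a Hurwitz dessin with automorphism group isomorphic to ${\rm PSL}_2(13)$. -/

import Mathlib

/-- A (finite, connected) dessin d'enfant with edge set `E`, given by its local monodromy
permutations: `x` and `y` rotate the edges around their incident black and white vertices, and
`z = (xy)⁻¹` rotates the edges around the incident faces.  The monodromy group `⟨x, y, z⟩` is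
transitive on the finite non-empty set of edges. -/
structure Dessin (E : Type*) where
  finite : Finite E
  nonempty : Nonempty E
  x : Equiv.Perm E
  y : Equiv.Perm E
  z : Equiv.Perm E
  mul_eq_one : x * y * z = 1
  transitive : MulAction.IsPretransitive (Subgroup.closure ({x, y, z} : Set (Equiv.Perm E))) E

namespace Dessin

/-- The number of cycles of a permutation, fixed points included. -/
noncomputable def numCycles {E : Type*} (σ : Equiv.Perm E) : ℕ :=
  Nat.card (Quotient (Equiv.Perm.SameCycle.setoid σ))

/-- The degree: the number of edges. -/
noncomputable def degree {E : Type*} (_D : Dessin E) : ℕ := Nat.card E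

/-- The Euler characteristic of the underlying surface:
black vertices plus white vertices minus edges plus faces. -/
noncomputable def eulerChar {E : Type*} (D : Dessin E) : ℤ :=
  numCycles D.x + numCycles D.y - D.degree + numCycles D.z

/-- The underlying closed oriented connected surface has genus `g`. -/
def HasGenus {E : Type*} (D : Dessin E) (g : ℕ) : Prop :=
  D.eulerChar = 2 - 2 * (g : ℤ)

/-- The monodromy group. -/
def monodromy {E : Type*} (D : Dessin E) : Subgroup (Equiv.Perm E) :=
  Subgroup.closure {D.x, D.y, D.z}

/-- The automorphism group: the centraliser of the monodromy group in the symmetric group. -/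
def Aut {E : Type*} (D : Dessin E) : Subgroup (Equiv.Perm E) :=
  Subgroup.centralizer (D.monodromy : Set (Equiv.Perm E))

/-- A dessin is regular if its automorphism group is transitive on the edges. -/
def IsRegular {E : Type*} (D : Dessin E) : Prop := MulAction.IsPretransitive D.Aut E

/-- The dessin has type `(a, b, c)`. -/
def HasType {E : Type*} (D : Dessin E) (a b c : ℕ) : Prop :=
  orderOf D.x = a ∧ orderOf D.y = b ∧ orderOf D.z = c

/-- A Hurwitz dessin: a regular dessin of type `(3, 2, 7)`. -/
def IsHurwitz {E : Type*} (D : Dessin E) : Prop := D.IsRegular ∧ D.HasType 3 2 7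

theorem x_mem {E : Type*} (D : Dessin E) : D.x ∈ D.monodromy :=
  Subgroup.subset_closure (by simp)

theorem y_mem {E : Type*} (D : Dessin E) : D.y ∈ D.monodromy :=
  Subgroup.subset_closure (by simp)

theorem z_mem {E : Type*} (D : Dessin E) : D.z ∈ D.monodromy :=
  Subgroup.subset_closure (by simp)

theorem aut_comm {E : Type*} (D : Dessin E) (h : D.Aut) {σ : Equiv.Perm E}
    (hσ : σ ∈ D.monodromy) (e : E) : σ (h • e) = h • σ e :=
  DFunLike.congr_fun (Subgroup.mem_centralizer_iff.mp h.2 σ hσ) e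

/-- The edges of the quotient by a group `H` of automorphisms: the orbits of `H` on edges. -/
abbrev QuotientEdges {E : Type*} (D : Dessin E) (H : Subgroup D.Aut) : Type _ :=
  MulAction.orbitRel.Quotient H E

theorem orbitRel_iff {E : Type*} (D : Dessin E) (H : Subgroup D.Aut) {σ : Equiv.Perm E}
    (hσ : σ ∈ D.monodromy) (a b : E) :
    MulAction.orbitRel H E a b ↔ MulAction.orbitRel H E (σ a) (σ b) := by
  simp only [MulAction.orbitRel_apply, MulAction.mem_orbit_iff]
  refine exists_congr fun h => ?_
  have key : σ (h • b) = h • σ b := D.aut_comm h.1 hσ b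
  rw [← key, σ.injective.eq_iff]

/-- The permutation of the `H`-orbits induced by an element of the monodromy group. -/
def quotientPerm {E : Type*} (D : Dessin E) (H : Subgroup D.Aut) (σ : Equiv.Perm E)
    (hσ : σ ∈ D.monodromy) : Equiv.Perm (D.QuotientEdges H) :=
  Quotient.congr σ (D.orbitRel_iff H hσ)

theorem quotientPerm_mk {E : Type*} (D : Dessin E) (H : Subgroup D.Aut) (σ : Equiv.Perm E)
    (hσ : σ ∈ D.monodromy) (e : E) :
    D.quotientPerm H σ hσ (Quotient.mk _ e) = Quotient.mk _ (σ e) := rfl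

/-- The quotient dessin `D / H`, for a group `H` of automorphisms of `D`. -/
def quotient {E : Type*} (D : Dessin E) (H : Subgroup D.Aut) : Dessin (D.QuotientEdges H) where
  finite := by
    have := D.finite
    exact Quotient.finite _
  nonempty := D.nonempty.map (Quotient.mk _)
  x := D.quotientPerm H D.x D.x_mem
  y := D.quotientPerm H D.y D.y_mem
  z := D.quotientPerm H D.z D.z_mem
  mul_eq_one := by
    ext e
    induction e using Quotient.inductionOn with
    | h e =>
      simp only [Equiv.Perm.mul_apply, quotientPerm_mk, Equiv.Perm.one_apply]
      rw [← Equiv.Perm.mul_apply, ← Equiv.Perm.mul_apply, D.mul_eq_one, Equiv.Perm.one_apply]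
  transitive := by
    have lift : ∀ σ ∈ D.monodromy, ∃ τ ∈ Subgroup.closure
        ({D.quotientPerm H D.x D.x_mem, D.quotientPerm H D.y D.y_mem,
          D.quotientPerm H D.z D.z_mem} : Set (Equiv.Perm (D.QuotientEdges H))),
        ∀ e : E, τ (Quotient.mk _ e) = Quotient.mk _ (σ e) := by
      intro σ hσ
      induction hσ using Subgroup.closure_induction with
      | mem s hs =>
        rcases hs with rfl | rfl | rfl
        · exact ⟨_, Subgroup.subset_closure (by simp), fun e => D.quotientPerm_mk H _ D.x_mem e⟩
        · exact ⟨_, Subgroup.subset_closure (by simp), fun e => D.quotientPerm_mk H _ D.y_mem e⟩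
        · exact ⟨_, Subgroup.subset_closure (by simp), fun e => D.quotientPerm_mk H _ D.z_mem e⟩
      | one => exact ⟨1, one_mem _, fun e => rfl⟩
      | mul s t _ _ hs ht =>
        obtain ⟨s', hs', hs⟩ := hs
        obtain ⟨t', ht', ht⟩ := ht
        refine ⟨s' * t', mul_mem hs' ht', fun e => ?_⟩
        rw [Equiv.Perm.mul_apply, ht, hs, Equiv.Perm.mul_apply]
      | inv s _ hs =>
        obtain ⟨s', hs', hs⟩ := hs
        refine ⟨s'⁻¹, inv_mem hs', fun e => ?_⟩
        rw [Equiv.Perm.inv_eq_iff_eq, hs, ← Equiv.Perm.mul_apply, mul_inv_cancel, Equiv.Perm.one_apply]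
    refine ⟨fun a b => ?_⟩
    induction a using Quotient.inductionOn with
    | h a =>
      induction b using Quotient.inductionOn with
      | h b =>
        obtain ⟨σ, hσ⟩ := D.transitive.exists_smul_eq a b
        obtain ⟨τ, hτ, h⟩ := lift σ.1 σ.2
        refine ⟨⟨τ, hτ⟩, ?_⟩
        exact (h a).trans (congrArg _ hσ)

/-- The quotient `D / H` of a dessin is faithful if the core of `H` in `Aut D` is trivial. -/
def IsFaithfulQuotient {E : Type*} (D : Dessin E) (H : Subgroup D.Aut) : Prop :=
  H.normalCore = ⊥

end Dessin

/-- The subgroup `H` is dihedral of order `k`. -/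
def IsDihedralOfOrder {G : Type*} [Group G] (H : Subgroup G) (k : ℕ) : Prop :=
  Nat.card H = k ∧ ∃ m : ℕ, Nonempty (H ≃* DihedralGroup m)

/-! Both genera come from counting fixed edges of x, y, z. Each has prime order, so Burnside turns
the number of fixed edges of the induced permutation into its cycle count (`prime_mul_numCycles`).
In a regular dessin, monodromy and automorphisms are commuting regular actions. Hence, when H is a
point stabiliser in a transitive `Aut`-set, the edges of the quotient are the points of that set,
and a monodromy element acts as an automorphism of the same order (`IsRegular.exists_equiv`).

Write q = 2u + 1. Since 7 divides |G| and q is prime to 42, u(u+1) = 42k, that is k = (q² - 1)/168.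
A Sylow p-subgroup has order q prime to 42, so x, y, z fix no edge of its quotient; the degree is
84k, the Euler characteristic -2k, and g = k + 1.

The dihedral subgroups of order q - 1 are exactly the stabilisers of unordered pairs on the
projective line (`exists_eq_stabilizer`), hence conjugate. On the q(q+1)/2 pairs the involution
fixes u + 1, while x and z fix at most one each, because a nontrivial element fixes at most two
points. The many fixed pairs of y raise the Euler characteristic, so g' < g although the degree has
grown by u + 1. Faithfulness is simplicity of PSL₂(q). For q = 13 explicit matrices generate
PSL₂(13), and right multiplication gives the dessin. -/

theorem card_orbits_mul_card_eq_of_card_fixedBy {C X : Type*} [Group C] [Finite C] [MulAction C X]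
    [Finite X] {k : ℕ} (h : ∀ c : C, c ≠ 1 → Nat.card (MulAction.fixedBy X c) = k) :
    Nat.card (MulAction.orbitRel.Quotient C X) * Nat.card C =
      Nat.card X + (Nat.card C - 1) * k := by
  classical
  have := Fintype.ofFinite C
  have := Fintype.ofFinite X
  have : Fintype (MulAction.orbitRel.Quotient C X) := Fintype.ofFinite _
  have key := MulAction.sum_card_fixedBy_eq_card_orbits_mul_card_group C X
  rw [Nat.card_eq_fintype_card, Nat.card_eq_fintype_card, Nat.card_eq_fintype_card]
  refine Eq.trans ?_ (key.symm.trans ?_)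
  · congr!
  rw [← Finset.add_sum_erase _ _ (Finset.mem_univ (1 : C))]
  congr 1
  · rw [← Nat.card_eq_fintype_card, ← Nat.card_eq_fintype_card]
    exact Nat.card_congr ((Equiv.setCongr (MulAction.fixedBy_one_eq_univ X C)).trans
      (Equiv.Set.univ X))
  · rw [Finset.sum_congr rfl (g := fun _ => k)]
    · simp [Finset.card_erase_of_mem]
    · intro c hc
      rw [← Nat.card_eq_fintype_card, h c (Finset.ne_of_mem_erase hc)]

/-! ### Cycle counts, free actions and edges of quotients -/

namespace Dessin

variable {E : Type*}

/-- Every nontrivial power of σ generates the same group, so it has the same fixed points and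
Burnside applies. Only σ ^ l = 1 is assumed because the permutation induced on a quotient may be
trivial. -/
theorem prime_mul_numCycles [Finite E] {l : ℕ} (hl : l.Prime) {σ : Equiv.Perm E}
    (hσ : σ ^ l = 1) :
    l * numCycles σ = Nat.card E + (l - 1) * Nat.card {e // σ e = e} := by
  have hset : Equiv.Perm.SameCycle.setoid σ = MulAction.orbitRel (Subgroup.zpowers σ) E := by
    ext a b
    rw [MulAction.orbitRel_apply]
    refine Equiv.Perm.sameCycle_comm.trans ⟨fun ⟨i, hi⟩ => ⟨⟨σ ^ i, i, rfl⟩, hi⟩, ?_⟩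
    rintro ⟨⟨_, i, rfl⟩, hi⟩
    exact ⟨i, hi⟩
  by_cases h1 : σ = 1
  · subst h1
    have h : numCycles (1 : Equiv.Perm E) = Nat.card E := by
      refine (Nat.card_congr (Equiv.ofBijective (Quotient.mk _) ⟨fun a b hab => ?_,
        Quotient.mk_surjective⟩)).symm
      exact Equiv.Perm.sameCycle_one.mp (Quotient.exact hab)
    rw [h, Nat.card_congr (Equiv.subtypeUnivEquiv (p := fun e => (1 : Equiv.Perm E) e = e)
      (fun _ => rfl))]
    obtain ⟨k, rfl⟩ := Nat.exists_eq_add_of_le' hl.one_le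
    simp only [Nat.add_sub_cancel]
    ring
  · have := Fact.mk hl
    have hord : orderOf σ = l := orderOf_eq_prime hσ h1
    have hcard : Nat.card (Subgroup.zpowers σ) = l := by rw [Nat.card_zpowers, hord]
    have hnum : numCycles σ =
        Nat.card (MulAction.orbitRel.Quotient (Subgroup.zpowers σ) E) := by
      rw [numCycles, hset]
    rw [hnum, mul_comm, ← hcard]
    refine card_orbits_mul_card_eq_of_card_fixedBy fun c hc => ?_
    refine Nat.card_congr (Equiv.subtypeEquivRight fun e => ⟨fun he => ?_, fun he => ?_⟩)
    · have hz : Subgroup.zpowers c = ⊤ := zpowers_eq_top_of_prime_card hcard hc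
      have hs : (⟨σ, Subgroup.mem_zpowers σ⟩ : Subgroup.zpowers σ) ∈ Subgroup.zpowers c := by
        rw [hz]; trivial
      have : Subgroup.zpowers c ≤ MulAction.stabilizer (Subgroup.zpowers σ) e := by
        rwa [Subgroup.zpowers_le]
      exact this hs
    · obtain ⟨_, i, rfl⟩ := c
      exact Equiv.Perm.zpow_apply_eq_self_of_apply_eq_self he i

/-- The centraliser of a transitive group acts freely: one value determines all the others. -/
theorem aut_eq_one (D : Dessin E) {h : D.Aut} {e : E} (he : h • e = e) : h = 1 := by
  refine Subtype.ext (Equiv.ext fun b => ?_)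
  obtain ⟨σ, rfl⟩ := D.transitive.exists_smul_eq e b
  have := D.aut_comm h σ.2 e
  rw [he] at this
  exact this.symm

theorem mul_card_quotientEdges (D : Dessin E) (H : Subgroup D.Aut) :
    Nat.card E = Nat.card (D.QuotientEdges H) * Nat.card H := by
  rw [← Nat.card_prod]
  refine Nat.card_congr (MulAction.selfEquivOrbitsQuotientProd fun b => ?_)
  rw [eq_bot_iff]
  intro h hh
  exact Subtype.ext (D.aut_eq_one (h := h.1) hh)

theorem IsRegular.card_aut {D : Dessin E} (hD : D.IsRegular) : Nat.card D.Aut = Nat.card E := by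
  obtain ⟨e₀⟩ := D.nonempty
  refine Nat.card_congr (Equiv.ofBijective (fun g : D.Aut => g • e₀)
    ⟨fun g h hgh => ?_, hD.exists_smul_eq e₀⟩)
  have : (h⁻¹ * g) • e₀ = e₀ := by rw [mul_smul, inv_smul_eq_iff]; exact hgh
  exact (inv_mul_eq_one.mp (D.aut_eq_one this)).symm

theorem IsRegular.eq_one_of_fixed {D : Dessin E} (hD : D.IsRegular) {σ : Equiv.Perm E}
    (hσ : σ ∈ D.monodromy) {e : E} (he : σ e = e) : σ = 1 := by
  refine Equiv.ext fun b => ?_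
  obtain ⟨g, rfl⟩ := hD.exists_smul_eq e b
  rw [D.aut_comm g hσ, he]; rfl

theorem pow_apply_of_apply_eq_smul (D : Dessin E) {σ : Equiv.Perm E} (hσ : σ ∈ D.monodromy)
    {a : D.Aut} {e : E} (ha : σ e = a • e) (i : ℕ) : (σ ^ i) e = a ^ i • e := by
  induction i with
  | zero => simp
  | succ i ih =>
    rw [pow_succ, Equiv.Perm.mul_apply, ha, D.aut_comm a (pow_mem hσ i), ih, pow_succ', mul_smul]

theorem quotientPerm_pow_eq_one (D : Dessin E) (H : Subgroup D.Aut) {σ : Equiv.Perm E}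
    (hσ : σ ∈ D.monodromy) {l : ℕ} (h : σ ^ l = 1) : D.quotientPerm H σ hσ ^ l = 1 := by
  have key : ∀ (i : ℕ) (e : E), (D.quotientPerm H σ hσ ^ i) (Quotient.mk _ e) =
      Quotient.mk _ ((σ ^ i) e) := by
    intro i e
    induction i with
    | zero => rfl
    | succ i ih =>
      rw [pow_succ', pow_succ', Equiv.Perm.mul_apply, ih, quotientPerm_mk, Equiv.Perm.mul_apply]
  ext w
  induction w using Quotient.inductionOn with
  | h e => rw [key, h]; rfl

/-- If the orders of `σ` and `H` are coprime then `σ` fixes no edge of the quotient by `H`. -/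
theorem IsRegular.quotientPerm_apply_ne {D : Dessin E} (hD : D.IsRegular) (H : Subgroup D.Aut)
    {σ : Equiv.Perm E} (hσ : σ ∈ D.monodromy) (hne : σ ≠ 1)
    (hco : (orderOf σ).Coprime (Nat.card H)) (w : D.QuotientEdges H) :
    D.quotientPerm H σ hσ w ≠ w := by
  induction w using Quotient.inductionOn with
  | h e =>
    intro h
    rw [quotientPerm_mk] at h
    obtain ⟨k, hk⟩ := Quotient.exact h
    -- A fixed orbit gives σ e = k e with k in H. Powers of σ and k agree at e, so the order of k
    -- divides both coprime numbers.
    have h1 : (k : D.Aut) ^ orderOf σ = 1 := by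
      apply D.aut_eq_one (e := e)
      rw [← D.pow_apply_of_apply_eq_smul hσ hk.symm, pow_orderOf_eq_one]; rfl
    have h2 : k = 1 := by
      rw [← orderOf_eq_one_iff]
      refine Nat.eq_one_of_dvd_coprimes hco (orderOf_dvd_of_pow_eq_one (Subtype.ext h1))
        (orderOf_dvd_natCard k)
    rw [h2] at hk
    exact hne (hD.eq_one_of_fixed hσ hk.symm)

/-- The edges of the quotient of a regular dessin by a point stabiliser in a transitive action
of the automorphism group are the points of that action. -/
theorem IsRegular.exists_equiv {D : Dessin E} (hD : D.IsRegular) {Y : Type*} [MulAction D.Aut Y]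
    [MulAction.IsPretransitive D.Aut Y] (s : Y) :
    Nonempty (D.QuotientEdges (MulAction.stabilizer D.Aut s) ≃ Y) ∧
    ∀ (σ : Equiv.Perm E) (hσ : σ ∈ D.monodromy), ∃ a : D.Aut, orderOf a = orderOf σ ∧
      Nat.card {w // D.quotientPerm (MulAction.stabilizer D.Aut s) σ hσ w = w} =
        Nat.card {y : Y // a • y = y} := by
  obtain ⟨e₀⟩ := D.nonempty
  choose γ hγ using hD.exists_smul_eq e₀
  have γ_eq : ∀ (g : D.Aut) (e : E), g • e₀ = e → γ e = g := by
    intro g e h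
    have : (g⁻¹ * γ e) • e₀ = e₀ := by rw [mul_smul, hγ, inv_smul_eq_iff, h]
    exact (inv_mul_eq_one.mp (D.aut_eq_one this)).symm
  have hrel : ∀ e e' : E, MulAction.orbitRel (MulAction.stabilizer D.Aut s) E e e' ↔
      (γ e)⁻¹ • s = (γ e')⁻¹ • s := by
    intro e e'
    rw [MulAction.orbitRel_apply]
    constructor
    · rintro ⟨k, hk⟩
      have : γ e = k.1 * γ e' := γ_eq _ _ (by rw [mul_smul, hγ]; exact hk)
      have hs : k.1⁻¹ • s = s := by rw [inv_smul_eq_iff]; exact k.2.symm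
      rw [this, mul_inv_rev, mul_smul, hs]
    · intro h
      refine ⟨⟨γ e * (γ e')⁻¹, ?_⟩, ?_⟩
      · rw [MulAction.mem_stabilizer_iff, mul_smul, ← h, smul_inv_smul]
      · change (γ e * (γ e')⁻¹) • e' = e
        rw [mul_smul, inv_smul_eq_iff.mpr (hγ e').symm, hγ]
  -- Here γ e is the unique automorphism taking the base edge to e. Left multiplication of γ e by
  -- the stabiliser does not change (γ e)⁻¹ • s.
  let f : D.QuotientEdges (MulAction.stabilizer D.Aut s) → Y :=
    Quotient.lift (fun e => (γ e)⁻¹ • s) fun e e' h => (hrel e e').mp h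
  have hf : Function.Bijective f := by
    constructor
    · intro w w'
      induction w using Quotient.inductionOn with
      | h e =>
        induction w' using Quotient.inductionOn with
        | h e' => exact fun h => Quotient.sound ((hrel e e').mpr h)
    · intro y
      obtain ⟨g, rfl⟩ := MulAction.exists_smul_eq D.Aut s y
      refine ⟨Quotient.mk _ (g⁻¹ • e₀), ?_⟩
      change (γ (g⁻¹ • e₀))⁻¹ • s = g • s
      rw [γ_eq _ _ rfl, inv_inv]
  refine ⟨⟨Equiv.ofBijective f hf⟩, fun σ hσ => ⟨γ (σ e₀), ?_, ?_⟩⟩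
  · have hpow : ∀ i : ℕ, σ ^ i = 1 ↔ γ (σ e₀) ^ i = 1 := by
      intro i
      have hp := D.pow_apply_of_apply_eq_smul hσ (hγ (σ e₀)).symm i
      constructor
      · intro h
        rw [h] at hp
        exact D.aut_eq_one hp.symm
      · intro h
        rw [h, one_smul] at hp
        exact hD.eq_one_of_fixed (pow_mem hσ i) hp
    apply Nat.dvd_antisymm
    · rw [orderOf_dvd_iff_pow_eq_one, ← hpow, pow_orderOf_eq_one]
    · rw [orderOf_dvd_iff_pow_eq_one, hpow, pow_orderOf_eq_one]
  · refine Nat.card_congr ((Equiv.ofBijective f hf).subtypeEquiv fun w => ?_)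
    -- Since σ commutes with automorphisms, γ (σ e) = γ e * γ (σ e₀): σ acts by multiplication on
    -- the other side.
    have hw : f (D.quotientPerm _ σ hσ w) = (γ (σ e₀))⁻¹ • f w := by
      induction w using Quotient.inductionOn with
      | h e =>
        change (γ (σ e))⁻¹ • s = (γ (σ e₀))⁻¹ • (γ e)⁻¹ • s
        rw [← mul_smul, ← mul_inv_rev, γ_eq (γ e * γ (σ e₀)) (σ e)]
        rw [mul_smul, hγ, ← D.aut_comm _ hσ, hγ]
    rw [← hf.1.eq_iff, hw, inv_smul_eq_iff, Equiv.ofBijective_apply, eq_comm]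

end Dessin

open scoped Pointwise

/-! ### Actions on pairs of points -/

section TwoTransitive

variable {G X : Type*} [Group G] [MulAction G X]

theorem smul_pair_eq_iff [DecidableEq X] (a : G) {u v : X} (huv : u ≠ v) :
    a • ({u, v} : Finset X) = {u, v} ↔ (a • u = u ∧ a • v = v) ∨ (a • u = v ∧ a • v = u) := by
  have huv' : a • u ≠ a • v := fun h => huv (smul_left_cancel a h)
  have : a • ({u, v} : Finset X) = {a • u, a • v} := by
    simp [Finset.smul_finset_def, Finset.image_insert]
  rw [this]
  constructor
  · intro h
    have h1 : a • u ∈ ({u, v} : Finset X) := h ▸ (by simp)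
    have h2 : a • v ∈ ({u, v} : Finset X) := h ▸ (by simp)
    simp only [Finset.mem_insert, Finset.mem_singleton] at h1 h2
    rcases h1 with h1 | h1 <;> rcases h2 with h2 | h2
    · exact absurd (h1.trans h2.symm) huv'
    · exact Or.inl ⟨h1, h2⟩
    · exact Or.inr ⟨h1, h2⟩
    · exact absurd (h1.trans h2.symm) huv'
  · rintro (⟨h1, h2⟩ | ⟨h1, h2⟩)
    · rw [h1, h2]
    · rw [h1, h2, Finset.pair_comm]

variable (G X) in
/-- Nontrivial elements of `G` fix at most two points of `X`. -/
def FixesAtMostTwo : Prop :=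
  ∀ (g : G) (a b c : X), a ≠ b → a ≠ c → b ≠ c → g • a = a → g • b = b → g • c = c → g = 1

theorem FixesAtMostTwo.card_fixedBy_le [Finite X] (h : FixesAtMostTwo G X) {g : G} (hg : g ≠ 1) :
    Nat.card (MulAction.fixedBy X g) ≤ 2 := by
  by_contra! hlt
  rw [Nat.card_coe_set_eq, Set.two_lt_ncard] at hlt
  obtain ⟨a, ha, b, hb, c, hc, hab, hac, hbc⟩ := hlt
  exact hg (h g a b c hab hac hbc ha hb hc)

/-- An element of odd order at least `3` stabilises at most one pair. -/
theorem FixesAtMostTwo.card_fixed_pairs_le_one [DecidableEq X] (h : FixesAtMostTwo G X) {a : G}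
    (ha : a ≠ 1) (hodd : Odd (orderOf a)) :
    Nat.card {t : Set.powersetCard X 2 // a • t = t} ≤ 1 := by
  have hmem : ∀ t : Set.powersetCard X 2, a • t = t → ∀ u ∈ (t : Finset X), a • u = u := by
    intro t ht u hu
    obtain ⟨k, hk⟩ := hodd
    -- The square of a fixes both points of a stable pair; as a has odd order it is a power of its
    -- square. Two distinct stable pairs would then give three fixed points.
    have hsq : ∀ w ∈ (t : Finset X), (a * a) • w = w := by
      obtain ⟨x, y, hxy, hxyt⟩ := Finset.card_eq_two.mp (Set.powersetCard.card_eq t)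
      have ht' : a • (t : Finset X) = t := by rw [← Set.powersetCard.coe_smul, ht]
      rw [hxyt, smul_pair_eq_iff a hxy] at ht'
      rw [hxyt]
      intro w hw
      simp only [Finset.mem_insert, Finset.mem_singleton] at hw
      rw [mul_smul]
      rcases ht' with ⟨h1, h2⟩ | ⟨h1, h2⟩ <;> rcases hw with rfl | rfl <;> simp [h1, h2]
    have hpow : ∀ i : ℕ, (a * a) ^ i • u = u := by
      intro i
      induction i with
      | zero => simp
      | succ i ih => rw [pow_succ, mul_smul, hsq u hu, ih]
    have h1 : a * (a * a) ^ k = 1 := by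
      rw [← pow_two, ← pow_mul, ← pow_succ', ← hk, pow_orderOf_eq_one]
    calc a • u = a • (a * a) ^ k • u := by rw [hpow]
      _ = u := by rw [← mul_smul, h1, one_smul]
  have : Subsingleton {t : Set.powersetCard X 2 // a • t = t} := by
    refine ⟨fun s t => Subtype.ext (Set.powersetCard.eq_iff_subset.mpr ?_)⟩
    obtain ⟨x, y, hxy, hxyt⟩ := Finset.card_eq_two.mp (Set.powersetCard.card_eq t.1)
    intro u hu
    have hu' := hmem s.1 s.2 u hu
    have hx := hmem t.1 t.2 x (by rw [hxyt]; simp)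
    have hy := hmem t.1 t.2 y (by rw [hxyt]; simp)
    by_contra hut
    rw [hxyt] at hut
    simp only [Finset.mem_insert, Finset.mem_singleton, not_or] at hut
    exact ha (h a x y u hxy (Ne.symm hut.1) (Ne.symm hut.2) hx hy hu')
  exact Finite.card_le_one_iff_subsingleton.mpr this

/-- If `X` has even cardinality, an involution stabilises exactly `|X| / 2` pairs. -/
theorem FixesAtMostTwo.two_mul_card_fixed_pairs [DecidableEq X] [Finite X]
    (h : FixesAtMostTwo G X) {a : G}
    (ha : orderOf a = 2) (hX : Even (Nat.card X)) :
    2 * Nat.card {t : Set.powersetCard X 2 // a • t = t} = Nat.card X := by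
  classical
  have := Fintype.ofFinite X
  have ha1 : a ≠ 1 := by rintro rfl; simp at ha
  have haa : ∀ u : X, a • a • u = u := by
    intro u
    rw [← mul_smul, ← pow_two, ← ha, pow_orderOf_eq_one, one_smul]
  -- the fixed points come in a pair or not at all
  have hfix : ∀ u : X, a • u = u → ∃ v, v ≠ u ∧ a • v = v := by
    intro u hu
    by_contra! hv
    have hcard : Nat.card (MulAction.fixedBy X a) = 1 := by
      rw [Nat.card_coe_set_eq, Set.ncard_eq_one]
      refine ⟨u, Set.eq_singleton_iff_unique_mem.mpr ⟨hu, fun v hv' => ?_⟩⟩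
      by_contra hne
      exact hv v hne hv'
    have hz : Nat.card (Subgroup.zpowers a) = 2 := by rw [Nat.card_zpowers, ha]
    have : IsPGroup 2 (Subgroup.zpowers a) := IsPGroup.of_card (n := 1) (by rw [hz]; rfl)
    have hmod := this.card_modEq_card_fixedPoints X
    have heq : MulAction.fixedPoints (Subgroup.zpowers a) X = MulAction.fixedBy X a := by
      ext w
      constructor
      · exact fun hw => hw ⟨a, Subgroup.mem_zpowers a⟩
      · intro hw k
        have : Subgroup.zpowers a ≤ MulAction.stabilizer G w := by rwa [Subgroup.zpowers_le]
        exact this k.2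
    rw [heq, hcard] at hmod
    rw [Nat.even_iff] at hX
    rw [Nat.ModEq, hX] at hmod
    omega
  let B : Finset (Finset X) := {s | s.card = 2 ∧ a • s = s}
  have hB : Nat.card {t : Set.powersetCard X 2 // a • t = t} = B.card := by
    rw [← Nat.card_eq_finsetCard]
    exact Nat.card_congr
      { toFun := fun t => ⟨t.1.1, Finset.mem_filter.mpr
          ⟨Finset.mem_univ _, Set.powersetCard.card_eq t.1, congrArg Subtype.val t.2⟩⟩
        invFun := fun s => ⟨⟨s.1, (Finset.mem_filter.mp s.2).2.1⟩,
          Subtype.ext (Finset.mem_filter.mp s.2).2.2⟩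
        left_inv := fun _ => rfl
        right_inv := fun _ => rfl }
  -- The stable pairs partition X: a moved point is paired with its image, a fixed point with the
  -- other fixed point.
  have hone : ∀ u : X, (B.filter (u ∈ ·)).card = 1 := by
    intro u
    have key : ∃ v, u ≠ v ∧ (∀ w, u ≠ w → (a • ({u, w} : Finset X) = {u, w} ↔ w = v)) := by
      by_cases hu : a • u = u
      · obtain ⟨v, hvu, hv⟩ := hfix u hu
        refine ⟨v, hvu.symm, fun w huw => ?_⟩
        rw [smul_pair_eq_iff a huw]
        constructor
        · rintro (⟨_, hw⟩ | ⟨hw, _⟩)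
          · by_contra hwv
            exact ha1 (h a u v w hvu.symm huw (Ne.symm hwv) hu hv hw)
          · exact absurd (hu.symm.trans hw) huw
        · rintro rfl
          exact Or.inl ⟨hu, hv⟩
      · refine ⟨a • u, fun h => hu h.symm, fun w huw => ?_⟩
        rw [smul_pair_eq_iff a huw]
        constructor
        · rintro (⟨hw, _⟩ | ⟨hw, _⟩)
          · exact absurd hw hu
          · exact hw.symm
        · rintro rfl
          exact Or.inr ⟨rfl, haa u⟩
    obtain ⟨v, huv, hv⟩ := key
    rw [Finset.card_eq_one]
    refine ⟨{u, v}, Finset.eq_singleton_iff_unique_mem.mpr ⟨?_, fun s hs => ?_⟩⟩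
    · simp only [B, Finset.mem_filter, Finset.mem_univ, true_and]
      exact ⟨⟨Finset.card_pair huv, (hv v huv).mpr rfl⟩, by simp⟩
    · simp only [B, Finset.mem_filter, Finset.mem_univ, true_and] at hs
      obtain ⟨⟨hs2, hs⟩, hus⟩ := hs
      obtain ⟨w, hw⟩ := Finset.card_eq_one.mp
        ((Finset.card_erase_of_mem hus).trans (by rw [hs2]))
      have hs' : s = {u, w} := by rw [← Finset.insert_erase hus, hw]
      have huw : u ≠ w := by
        rintro rfl
        exact Finset.notMem_erase u s (hw ▸ Finset.mem_singleton_self u)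
      rw [hs'] at hs ⊢
      rw [(hv w huw).mp hs]
  have hsum := Finset.sum_card hone
  rw [Finset.sum_congr rfl (g := fun _ => 2) (fun s hs => by simp [B] at hs; exact hs.1)] at hsum
  rw [hB, Nat.card_eq_fintype_card, ← mul_one (Fintype.card X), ← hsum]
  simp [mul_comm]

/-- The action of `G` on a set of `q + 1` points resembles that of `PSL₂(q)` on the projective
line. -/
structure IsProjectiveLineAction (G X : Type*) [Group G] [MulAction G X] [DecidableEq X]
    (q : ℕ) : Prop where
  card : Nat.card X = q + 1
  fixes : FixesAtMostTwo G X
  transitive : MulAction.IsMultiplyPretransitive G X 2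
  dihedral : ∃ t : Set.powersetCard X 2, IsDihedralOfOrder (MulAction.stabilizer G t) (q - 1)

namespace IsProjectiveLineAction

variable [DecidableEq X] {q : ℕ}

theorem isPretransitive (h : IsProjectiveLineAction G X q) :
    MulAction.IsPretransitive G (Set.powersetCard X 2) :=
  Set.powersetCard.isPretransitive_of_isMultiplyPretransitive _ h.transitive

theorem card_pairs (h : IsProjectiveLineAction G X q) :
    Nat.card (Set.powersetCard X 2) = (q + 1).choose 2 := by
  rw [Set.powersetCard.card, h.card]

theorem card_stabilizer (h : IsProjectiveLineAction G X q) (t : Set.powersetCard X 2) :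
    Nat.card (MulAction.stabilizer G t) = q - 1 := by
  obtain ⟨s, hs⟩ := h.dihedral
  have := h.isPretransitive
  rw [← hs.1]
  exact Nat.card_congr (MulAction.stabilizerEquivStabilizerOfOrbitRel
    (MulAction.orbitRel_apply.mpr (MulAction.exists_smul_eq G s t))).toEquiv

theorem card_group (h : IsProjectiveLineAction G X q) :
    Nat.card G = (q + 1).choose 2 * (q - 1) := by
  obtain ⟨t, ht⟩ := h.dihedral
  have := h.isPretransitive
  rw [← h.card_pairs, ← ht.1, ← MulAction.index_stabilizer_of_transitive G t,
    Subgroup.index_mul_card]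

/-- Some rotation in H fixes exactly two points. H conjugates it to itself or its inverse, so H
preserves those two points; equality with the stabiliser follows by order. -/
theorem exists_eq_stabilizer [Finite G] (h : IsProjectiveLineAction G X q) (hq : 6 ≤ q)
    {H : Subgroup G} (hH : IsDihedralOfOrder H (q - 1)) :
    ∃ t : Set.powersetCard X 2, H = MulAction.stabilizer G t := by
  have : Finite X := Nat.finite_of_card_ne_zero (by rw [h.card]; omega)
  obtain ⟨hcard, m, ⟨φ⟩⟩ := hH
  have hm : q - 1 = 2 * m := by
    rw [← hcard, Nat.card_congr φ.toEquiv, DihedralGroup.nat_card]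
  obtain ⟨r, hr⟩ : ∃ r : G, r = (φ.symm (DihedralGroup.r 1) : H) := ⟨_, rfl⟩
  have hord : orderOf r = m := by
    rw [hr, Subgroup.orderOf_coe, MulEquiv.orderOf_eq, DihedralGroup.orderOf_r_one]
  have hcardC : Nat.card (Subgroup.zpowers r) = m := by rw [Nat.card_zpowers, hord]
  have hconj : ∀ g ∈ H, ∀ s ∈ Subgroup.zpowers r, g⁻¹ * s * g = s ∨ g⁻¹ * s * g = s⁻¹ := by
    rintro g hg _ ⟨i, rfl⟩
    have hi : r ^ i = (φ.symm (DihedralGroup.r (i : ZMod m)) : H) := by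
      rw [hr, ← DihedralGroup.r_one_zpow, map_zpow]; rfl
    have hg' : g = (φ.symm (φ ⟨g, hg⟩) : H) := by simp
    simp only [hi]
    rw [hg']
    rcases φ ⟨g, hg⟩ with j | j
    · left
      norm_cast
      rw [← map_inv, ← map_mul, ← map_mul]
      simp
    · right
      norm_cast
      rw [← map_inv, ← map_inv, ← map_mul, ← map_mul]
      simp
  have key : ∃ s ∈ Subgroup.zpowers r, Nat.card (MulAction.fixedBy X s) = 2 := by
    by_contra! hno
    have hle : ∀ c : Subgroup.zpowers r, c ≠ 1 → Nat.card (MulAction.fixedBy X (c : G)) ≤ 1 := by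
      intro c hc
      have h1 := h.fixes.card_fixedBy_le (g := (c : G)) (by simpa using hc)
      have h2 := hno c c.2
      omega
    -- The rotations commute, so a point that is the only fixed point of one rotation is fixed by
    -- all of them.
    have hconst : ∃ k ≤ 1, ∀ c : Subgroup.zpowers r, c ≠ 1 →
        Nat.card (MulAction.fixedBy X c) = k := by
      by_cases h0 : ∀ c : Subgroup.zpowers r, c ≠ 1 → Nat.card (MulAction.fixedBy X (c : G)) = 0
      · exact ⟨0, by simp, h0⟩
      · push Not at h0
        obtain ⟨c, hc, hc0⟩ := h0
        have hc1 : Nat.card (MulAction.fixedBy X (c : G)) = 1 := by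
          have := hle c hc
          omega
        rw [Nat.card_coe_set_eq, Set.ncard_eq_one] at hc1
        obtain ⟨P, hP⟩ := hc1
        have hfixP : ∀ d : Subgroup.zpowers r, (d : G) • P = P := by
          intro d
          have hPc : P ∈ MulAction.fixedBy X (c : G) := by rw [hP]; rfl
          have : (d : G) • P ∈ MulAction.fixedBy X (c : G) := by
            rw [MulAction.mem_fixedBy] at hPc ⊢
            rw [← mul_smul, ← Subgroup.coe_mul, (Subgroup.zpowers_isMulCommutative r).is_comm.comm c d, Subgroup.coe_mul, mul_smul, hPc]
          rw [hP] at this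
          exact this
        refine ⟨1, le_rfl, fun d hd => le_antisymm (hle d hd) ?_⟩
        have : Nonempty (MulAction.fixedBy X d) := ⟨⟨P, hfixP d⟩⟩
        exact Nat.card_pos
    obtain ⟨k, hk1, hk⟩ := hconst
    have hb := card_orbits_mul_card_eq_of_card_fixedBy hk
    rw [hcardC, h.card] at hb
    have hd : m ∣ q + 1 + (m - 1) * k := hb ▸ Dvd.intro_left _ rfl
    have hk' : k = 0 ∨ k = 1 := by omega
    rcases hk' with rfl | rfl
    -- As q + 1 = 2m + 2, Burnside makes m divide 2 when k = 0 and 1 when k = 1, but m ≥ 3.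
    · rw [show q + 1 + (m - 1) * 0 = m * 2 + 2 by omega, Nat.dvd_add_right ⟨2, rfl⟩] at hd
      have := Nat.le_of_dvd (by norm_num) hd
      omega
    · rw [show q + 1 + (m - 1) * 1 = m * 3 + 1 by omega, Nat.dvd_add_right ⟨3, rfl⟩] at hd
      have := Nat.le_of_dvd (by norm_num) hd
      omega
  obtain ⟨s, hs, hs2⟩ := key
  have hfin : (MulAction.fixedBy X s).Finite := Set.toFinite _
  let t : Set.powersetCard X 2 := ⟨hfin.toFinset, by
    rw [Set.powersetCard.mem_iff, ← Set.ncard_eq_toFinset_card _ hfin, ← Nat.card_coe_set_eq, hs2]⟩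
  refine ⟨t, Subgroup.eq_of_le_of_card_ge (fun g hg => ?_) ?_⟩
  · rw [MulAction.mem_stabilizer_iff]
    refine Set.powersetCard.eq_iff_subset.mpr ?_
    rw [Set.powersetCard.coe_smul]
    intro u hu
    rw [Finset.mem_smul_finset] at hu
    obtain ⟨v, hv, rfl⟩ := hu
    have hv' : s • v = v := by simpa [t] using hv
    have hinv : s⁻¹ • v = v := by rw [inv_smul_eq_iff, hv']
    have : s • g • v = g • v := by
      rw [← inv_smul_eq_iff, ← mul_smul, ← mul_smul]
      rcases hconj g hg s hs with h1 | h1 <;> rw [h1] <;> assumption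
    simpa [t] using this
  · rw [h.card_stabilizer, hcard]

theorem exists_map_conj_eq [Finite G] (h : IsProjectiveLineAction G X q) (hq : 6 ≤ q)
    {H₁ H₂ : Subgroup G} (hH₁ : IsDihedralOfOrder H₁ (q - 1))
    (hH₂ : IsDihedralOfOrder H₂ (q - 1)) :
    ∃ a : G, H₁.map (MulAut.conj a).toMonoidHom = H₂ := by
  obtain ⟨s, rfl⟩ := h.exists_eq_stabilizer hq hH₁
  obtain ⟨t, rfl⟩ := h.exists_eq_stabilizer hq hH₂
  have := h.isPretransitive
  obtain ⟨a, rfl⟩ := MulAction.exists_smul_eq G s t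
  exact ⟨a, (MulAction.stabilizer_smul_eq_stabilizer_map_conj a s).symm⟩

end IsProjectiveLineAction

end TwoTransitive

open scoped LinearAlgebra.Projectivization MatrixGroups

/-! ### Recognising dihedral groups -/

section Dihedral

variable {N : Type*} [Group N]

/-- A group generated by an element of order `m` and an outside involution inverting it is
dihedral. -/
theorem nonempty_mulEquiv_dihedralGroup {m : ℕ} {r s : N} (hr : orderOf r = m) (hs : s * s = 1)
    (hsr : s * r * s⁻¹ = r⁻¹) (hns : s ∉ Subgroup.zpowers r)
    (htop : ∀ g : N, g ∈ Subgroup.zpowers r ∨ s * g ∈ Subgroup.zpowers r) :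
    Nonempty (N ≃* DihedralGroup m) := by
  have hzr : (zmultiplesHom (Additive N) (Additive.ofMul r)) m = 0 := by
    have : r ^ m = 1 := hr ▸ pow_orderOf_eq_one r
    simpa [zmultiplesHom_apply] using congrArg Additive.ofMul this
  let L : ZMod m →+ Additive N := ZMod.lift m ⟨zmultiplesHom (Additive N) (Additive.ofMul r), hzr⟩
  let ρ : ZMod m → N := fun i => (L i).toMul
  have ρ_int : ∀ i : ℤ, ρ i = r ^ i := by
    intro i
    simp [ρ, L]
  have ρ_add : ∀ i j, ρ (i + j) = ρ i * ρ j := by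
    intro i j
    simp [ρ]
  have ρ_neg : ∀ i, ρ (-i) = (ρ i)⁻¹ := by
    intro i
    simp [ρ]
  have ρ_mem : ∀ i, ρ i ∈ Subgroup.zpowers r := by
    intro i
    obtain ⟨k, rfl⟩ := ZMod.intCast_surjective i
    rw [ρ_int]
    exact ⟨k, rfl⟩
  have ρ_conj : ∀ i, ρ i * s = s * ρ (-i) := by
    intro i
    obtain ⟨k, rfl⟩ := ZMod.intCast_surjective i
    have h1 : s * r ^ k * s⁻¹ = (r ^ k)⁻¹ := by rw [← conj_zpow, hsr, inv_zpow]
    rw [ρ_neg, ρ_int, ← h1, ← mul_assoc, ← mul_assoc, hs, one_mul, inv_eq_of_mul_eq_one_left hs]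
  have ρ_inj : ∀ i, ρ i = 1 → i = 0 := by
    intro i hi
    obtain ⟨k, rfl⟩ := ZMod.intCast_surjective i
    rw [ρ_int, ← orderOf_dvd_iff_zpow_eq_one, hr] at hi
    exact (ZMod.intCast_zmod_eq_zero_iff_dvd k m).mpr hi
  let f : DihedralGroup m →* N := MonoidHom.mk'
    (fun x => match x with
      | .r i => ρ i
      | .sr i => s * ρ i) (by
    rintro (i | i) (j | j)
    · exact ρ_add i j
    · change s * ρ (j - i) = ρ i * (s * ρ j)
      rw [← mul_assoc, ρ_conj, mul_assoc, ← ρ_add, sub_eq_neg_add]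
    · change s * ρ (i + j) = s * ρ i * ρ j
      rw [mul_assoc, ρ_add]
    · change ρ (j - i) = s * ρ i * (s * ρ j)
      rw [← mul_assoc, mul_assoc s, ρ_conj, ← mul_assoc, hs, one_mul, ← ρ_add, sub_eq_neg_add])
  refine ⟨(MulEquiv.ofBijective f ⟨(injective_iff_map_eq_one f).mpr ?_, fun g => ?_⟩).symm⟩
  · rintro (i | i) h
    · rw [ρ_inj i h]; rfl
    · change s * ρ i = 1 at h
      refine absurd ?_ hns
      rw [eq_inv_of_mul_eq_one_left h]
      exact inv_mem (ρ_mem i)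
  · rcases htop g with ⟨k, hk⟩ | ⟨k, hk⟩
    · exact ⟨.r k, (ρ_int k).trans hk⟩
    · refine ⟨.sr k, ?_⟩
      change s * ρ k = g
      rw [ρ_int]
      change r ^ k = s * g at hk
      rw [hk, ← mul_assoc, hs, one_mul]

end Dihedral

/-! ### PSL₂ acting on the projective line -/

namespace Matrix.ProjectiveSpecialLinearGroup

variable {F : Type*} [Field F]

theorem mk_eq_one_iff {A : SL(2, F)} :
    (A : PSL(2, F)) = 1 ↔ A 0 1 = 0 ∧ A 1 0 = 0 ∧ A 0 0 = A 1 1 := by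
  rw [QuotientGroup.eq_one_iff, Matrix.SpecialLinearGroup.mem_center_iff]
  constructor
  · rintro ⟨r, -, hr⟩
    rw [← hr]
    simp
  · rintro ⟨h1, h2, h3⟩
    have hd := A.det_coe
    rw [Matrix.det_fin_two, h1, h2] at hd
    refine ⟨A 0 0, ?_, ?_⟩
    · rw [Fintype.card_fin]
      linear_combination hd + A 0 0 * h3
    · ext i j
      fin_cases i <;> fin_cases j <;> simp [h1, h2, h3]

theorem projectivization_mk_eq_iff {u v : Fin 2 → F} (hu : u ≠ 0) (hv : v ≠ 0) :
    Projectivization.mk F u hu = Projectivization.mk F v hv ↔ u 0 * v 1 = u 1 * v 0 := by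
  rw [Projectivization.mk_eq_mk_iff']
  constructor
  · rintro ⟨a, rfl⟩
    simp only [Pi.smul_apply, smul_eq_mul]
    ring
  · intro h
    by_cases h0 : v 0 = 0
    · have h1 : v 1 ≠ 0 := fun h1 => hv (by ext i; fin_cases i <;> assumption)
      have hu0 : u 0 = 0 := by simpa [h0, h1] using h
      refine ⟨u 1 / v 1, ?_⟩
      ext i
      fin_cases i
      · simp [h0, hu0]
      · simp [h1]
    · refine ⟨u 0 / v 0, ?_⟩
      ext i
      fin_cases i
      · simp [h0]
      · simp only [Fin.mk_one, Pi.smul_apply, smul_eq_mul]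
        field_simp
        linear_combination h

theorem mk_smul_mk_eq_iff (A : SL(2, F)) {u v : Fin 2 → F} (hu : u ≠ 0) (hv : v ≠ 0) :
    (A : PSL(2, F)) • Projectivization.mk F u hu = Projectivization.mk F v hv ↔
      (A 0 0 * u 0 + A 0 1 * u 1) * v 1 = (A 1 0 * u 0 + A 1 1 * u 1) * v 0 := by
  rw [smul_proj_mk, Projectivization.smul_mk, projectivization_mk_eq_iff]
  have : A • u = ![A 0 0 * u 0 + A 0 1 * u 1, A 1 0 * u 0 + A 1 1 * u 1] := by
    rw [← Matrix.mulVec_fin_two]; rfl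
  rw [this]
  simp

/-- The fixed points of A are the zeros of a binary quadratic form with coefficients A 0 1, A 0 0 -
A 1 1 and -A 1 0. Three distinct zeros make it vanish, so A is scalar. `hne` is the Vandermonde
determinant of the system, and the multipliers below are its cofactors. -/
theorem fixesAtMostTwo : FixesAtMostTwo PSL(2, F) (ℙ F (Fin 2 → F)) := by
  intro g a b c hab hac hbc ha hb hc
  obtain ⟨A, rfl⟩ := QuotientGroup.mk_surjective g
  induction a using Projectivization.ind with | _ u hu =>
  induction b using Projectivization.ind with | _ v hv =>
  induction c using Projectivization.ind with | _ w hw =>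
  rw [mk_smul_mk_eq_iff] at ha hb hc
  rw [Ne, projectivization_mk_eq_iff, ← sub_eq_zero] at hab hac hbc
  have hne := mul_ne_zero (mul_ne_zero hab hac) hbc
  rw [mk_eq_one_iff]
  refine ⟨?_, ?_, ?_⟩
  · refine (mul_eq_zero.mp ?_).resolve_right hne
    linear_combination 1 * ((v 0 * w 0) * (v 0 * w 1 - v 1 * w 0) * ha - (u 0 * w 0) * (u 0 * w 1 - u 1 * w 0) * hb +
      (u 0 * v 0) * (u 0 * v 1 - u 1 * v 0) * hc)
  · refine (mul_eq_zero.mp ?_).resolve_right hne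
    linear_combination -1 * ((v 1 * w 1) * (v 0 * w 1 - v 1 * w 0) * ha - (u 1 * w 1) * (u 0 * w 1 - u 1 * w 0) * hb +
      (u 1 * v 1) * (u 0 * v 1 - u 1 * v 0) * hc)
  · rw [← sub_eq_zero]
    refine (mul_eq_zero.mp ?_).resolve_right hne
    linear_combination -1 * ((v 0 * w 1 + v 1 * w 0) * (v 0 * w 1 - v 1 * w 0) * ha - (u 0 * w 1 + u 1 * w 0) * (u 0 * w 1 - u 1 * w 0) * hb +
      (u 0 * v 1 + u 1 * v 0) * (u 0 * v 1 - u 1 * v 0) * hc)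

theorem isMultiplyPretransitive :
    MulAction.IsMultiplyPretransitive PSL(2, F) (ℙ F (Fin 2 → F)) 2 := by
  rw [MulAction.is_two_pretransitive_iff]
  intro a b c d hab hcd
  obtain ⟨g, h⟩ := (MulAction.is_two_pretransitive_iff (G := SL(2, F))).mp inferInstance hab hcd
  exact ⟨g, h⟩

theorem card_projectivization [Finite F] : Nat.card (ℙ F (Fin 2 → F)) = Nat.card F + 1 :=
  Projectivization.card_of_finrank_two _ _ (by simp)

/-- The diagonal torus. -/
def diag (F : Type*) [Field F] : Fˣ →* SL(2, F) where
  toFun t := ⟨!![(t : F), 0; 0, ((t⁻¹ : Fˣ) : F)], by simp⟩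
  map_one' := by
    ext i j
    fin_cases i <;> fin_cases j <;> simp
  map_mul' s t := by
    refine Subtype.ext (Eq.trans ?_ (Matrix.SpecialLinearGroup.coe_mul _ _).symm)
    ext i j
    fin_cases i <;> fin_cases j <;> simp [Matrix.mul_apply, mul_comm]

theorem coe_diag (a : Fˣ) : (diag F a : Matrix (Fin 2) (Fin 2) F) =
    !![(a : F), 0; 0, ((a⁻¹ : Fˣ) : F)] := rfl

/-- The Weyl element. -/
def weyl (F : Type*) [Field F] : SL(2, F) := ⟨!![0, 1; -1, 0], by simp⟩

theorem coe_weyl : (weyl F : Matrix (Fin 2) (Fin 2) F) = !![0, 1; -1, 0] := rfl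

/-- The stabiliser of the two coordinate points consists of the diagonal and antidiagonal matrices.
The diagonal ones form a cyclic group, of order (|F| - 1)/2 modulo ±1, which the Weyl element
inverts. -/
theorem exists_isDihedralOfOrder_stabilizer [Finite F] [DecidableEq (ℙ F (Fin 2 → F))]
    (h2 : (2 : F) ≠ 0) :
    ∃ t : Set.powersetCard (ℙ F (Fin 2 → F)) 2,
      IsDihedralOfOrder (MulAction.stabilizer PSL(2, F) t) (Nat.card F - 1) := by
  have hu1 : (![1, 0] : Fin 2 → F) ≠ 0 := fun h => by simpa using congrFun h 0
  have hv1 : (![0, 1] : Fin 2 → F) ≠ 0 := fun h => by simpa using congrFun h 1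
  have hne : Projectivization.mk F ![1, 0] hu1 ≠ Projectivization.mk F ![0, 1] hv1 := by
    rw [Ne, projectivization_mk_eq_iff]; simp
  let t : Set.powersetCard (ℙ F (Fin 2 → F)) 2 :=
    ⟨{Projectivization.mk F ![1, 0] hu1, Projectivization.mk F ![0, 1] hv1}, Finset.card_pair hne⟩
  have hstab : ∀ A : SL(2, F), (A : PSL(2, F)) ∈ MulAction.stabilizer PSL(2, F) t ↔
      (A 1 0 = 0 ∧ A 0 1 = 0) ∨ (A 0 0 = 0 ∧ A 1 1 = 0) := by
    intro A
    rw [MulAction.mem_stabilizer_iff, ← Subtype.coe_inj, Set.powersetCard.coe_smul]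
    refine (smul_pair_eq_iff _ hne).trans ?_
    simp only [mk_smul_mk_eq_iff]
    simp only [Matrix.cons_val_zero, Matrix.cons_val_one, mul_zero, mul_one, add_zero, zero_add]
    rw [@eq_comm _ 0 (A 1 0), @eq_comm _ 0 (A 1 1)]
  obtain ⟨u, hu⟩ := IsCyclic.exists_generator (α := Fˣ)
  have hou : orderOf u = Nat.card F - 1 := by
    rw [orderOf_eq_card_of_forall_mem_zpowers hu, Nat.card_units]
  obtain ⟨m, hm⟩ : ∃ m, Nat.card F - 1 = 2 * m := by
    rw [← hou]
    -- The unit -1 has order two, so the number of units is even.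
    have : orderOf (-1 : Fˣ) = 2 := by
      refine orderOf_eq_prime (by simp) fun h => h2 ?_
      have := congrArg Units.val h
      push_cast at this
      linear_combination -this
    rw [orderOf_eq_card_of_forall_mem_zpowers hu, ← this]
    exact orderOf_dvd_natCard _
  have hdiag : ∀ a : Fˣ, (diag F a : PSL(2, F)) = 1 ↔ a ^ 2 = 1 := by
    intro a
    rw [mk_eq_one_iff]
    simp only [coe_diag, ← Units.val_inj]
    simp [pow_two, ← mul_eq_one_iff_eq_inv₀]
  let r : MulAction.stabilizer PSL(2, F) t := ⟨(diag F u : PSL(2, F)), by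
    rw [hstab]; left; simp [coe_diag]⟩
  let s : MulAction.stabilizer PSL(2, F) t := ⟨(weyl F : PSL(2, F)), by
    rw [hstab]; right; simp [weyl]⟩
  have hzp : ∀ A : SL(2, F), ∀ hA, A 0 1 = 0 → A 1 0 = 0 →
      (⟨(A : PSL(2, F)), hA⟩ : MulAction.stabilizer PSL(2, F) t) ∈ Subgroup.zpowers r := by
    intro A hA h01 h10
    have hd := A.det_coe
    rw [Matrix.det_fin_two, h01, zero_mul, sub_zero] at hd
    obtain ⟨k, hk⟩ := hu (Units.mkOfMulEqOne _ _ hd)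
    refine ⟨k, Subtype.ext ?_⟩
    change (diag F u : PSL(2, F)) ^ k = A
    rw [← QuotientGroup.mk_zpow, ← map_zpow]
    change u ^ k = _ at hk
    rw [hk]
    congr 1
    ext i j
    fin_cases i <;> fin_cases j <;> simp [coe_diag, h01, h10]
    exact inv_eq_of_mul_eq_one_right hd
  have hpow : ∀ k : ℕ, r ^ k = 1 ↔ m ∣ k := by
    intro k
    rw [← Subtype.coe_inj]
    change (diag F u : PSL(2, F)) ^ k = 1 ↔ _
    rw [← QuotientGroup.mk_pow, ← map_pow, hdiag, ← pow_mul, ← orderOf_dvd_iff_pow_eq_one, hou, hm,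
      mul_comm, Nat.mul_dvd_mul_iff_right two_pos]
  have hor : orderOf r = m := Nat.dvd_antisymm
    (orderOf_dvd_of_pow_eq_one ((hpow m).mpr dvd_rfl)) ((hpow _).mp (pow_orderOf_eq_one r))
  have hequiv : Nonempty (MulAction.stabilizer PSL(2, F) t ≃* DihedralGroup m) := by
    refine nonempty_mulEquiv_dihedralGroup (r := r) (s := s) hor ?_ ?_ ?_ ?_
    · refine Subtype.ext ?_
      change ((weyl F * weyl F : SL(2, F)) : PSL(2, F)) = 1
      rw [mk_eq_one_iff, Matrix.SpecialLinearGroup.coe_mul, coe_weyl]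
      simp
    · refine Subtype.ext ?_
      change ((weyl F * diag F u * (weyl F)⁻¹ : SL(2, F)) : PSL(2, F)) =
        (((diag F u)⁻¹ : SL(2, F)) : PSL(2, F))
      congr 1
      rw [mul_inv_eq_iff_eq_mul, ← map_inv]
      ext i j
      rw [Matrix.SpecialLinearGroup.coe_mul, Matrix.SpecialLinearGroup.coe_mul, coe_weyl, coe_diag,
        coe_diag]
      fin_cases i <;> fin_cases j <;> simp
    · rintro ⟨k, hk⟩
      have hk' := congrArg Subtype.val hk
      change (diag F u : PSL(2, F)) ^ k = (weyl F : PSL(2, F)) at hk'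
      rw [← QuotientGroup.mk_zpow, ← map_zpow, ← inv_mul_eq_one, ← QuotientGroup.mk_inv,
        ← QuotientGroup.mk_mul, ← map_inv, mk_eq_one_iff, Matrix.SpecialLinearGroup.coe_mul,
        coe_weyl, coe_diag] at hk'
      have h0 : (u : F) ^ k = 0 := by simpa using hk'
      exact zpow_ne_zero k u.ne_zero h0
    · rintro ⟨g, hg⟩
      obtain ⟨A, rfl⟩ := QuotientGroup.mk_surjective g
      rcases (hstab A).mp hg with ⟨h10, h01⟩ | ⟨h00, h11⟩
      · exact Or.inl (hzp A hg h01 h10)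
      · right
        refine hzp (weyl F * A) (mul_mem s.2 hg) ?_ ?_ <;>
        rw [Matrix.SpecialLinearGroup.coe_mul, coe_weyl] <;>
        simp [Matrix.mul_apply, h00, h11]
  refine ⟨t, ?_, m, hequiv⟩
  rw [Nat.card_congr hequiv.some.toEquiv, DihedralGroup.nat_card, hm]

end Matrix.ProjectiveSpecialLinearGroup

/-! ### Regular dessins from generating triples -/

namespace Dessin

section RightRegular

variable {G : Type*} [Group G]

theorem exists_mem_closure_mulRight {a b c : G}
    (hgen : Subgroup.closure ({a, b, c} : Set G) = ⊤) (k : G) :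
    Equiv.mulRight k ∈ Subgroup.closure
      ({Equiv.mulRight a, Equiv.mulRight b, Equiv.mulRight c} : Set (Equiv.Perm G)) := by
  have hk : k ∈ Subgroup.closure ({a, b, c} : Set G) := hgen ▸ Subgroup.mem_top k
  induction hk using Subgroup.closure_induction with
  | mem s hs => rcases hs with rfl | rfl | rfl <;> exact Subgroup.subset_closure (by simp)
  | one => rw [Equiv.mulRight_one]; exact one_mem _
  | mul s t _ _ hs ht => rw [Equiv.mulRight_mul]; exact mul_mem ht hs
  | inv s _ hs => rw [← Equiv.inv_mulRight]; exact inv_mem hs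

/-- The dessin on a finite group with generators `a`, `b`, `c` acting by right multiplication. -/
def rightRegular [Finite G] (a b c : G) (h : c * b * a = 1)
    (hgen : Subgroup.closure ({a, b, c} : Set G) = ⊤) : Dessin G where
  finite := inferInstance
  nonempty := ⟨1⟩
  x := Equiv.mulRight a
  y := Equiv.mulRight b
  z := Equiv.mulRight c
  mul_eq_one := by
    ext g
    simp only [Equiv.Perm.mul_apply, Equiv.coe_mulRight, Equiv.Perm.one_apply]
    -- Right multiplications compose in reverse order, whence the relation c * b * a = 1.
    rw [mul_assoc, mul_assoc, ← mul_assoc c, h, mul_one]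
  transitive := ⟨fun g k =>
    ⟨⟨_, exists_mem_closure_mulRight hgen (g⁻¹ * k)⟩, mul_inv_cancel_left g k⟩⟩

variable [Finite G] {a b c : G} (h : c * b * a = 1)
  (hgen : Subgroup.closure ({a, b, c} : Set G) = ⊤)

theorem mulLeft_mem_aut (g : G) : Equiv.mulLeft g ∈ (rightRegular a b c h hgen).Aut := by
  rw [Aut, monodromy, Subgroup.centralizer_closure, Subgroup.mem_centralizer_iff]
  rintro s (rfl | rfl | rfl) <;> ext k <;> exact mul_assoc _ _ _

theorem rightRegular_isRegular : (rightRegular a b c h hgen).IsRegular :=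
  ⟨fun g k => ⟨⟨_, mulLeft_mem_aut h hgen (k * g⁻¹)⟩, inv_mul_cancel_right k g⟩⟩

/-- An automorphism commutes with all right multiplications, so it is left multiplication by its
value at 1. -/
theorem nonempty_aut_rightRegular_mulEquiv :
    Nonempty ((rightRegular a b c h hgen).Aut ≃* G) := by
  let f : G →* (rightRegular a b c h hgen).Aut := MonoidHom.mk'
    (fun g => ⟨_, mulLeft_mem_aut h hgen g⟩) fun g k => Subtype.ext (Equiv.mulLeft_mul g k)
  refine ⟨(MulEquiv.ofBijective f ⟨fun g k hgk => ?_, fun σ => ⟨σ.1 1, ?_⟩⟩).symm⟩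
  · have := Equiv.congr_fun (congrArg Subtype.val hgk) 1
    simpa [f] using this
  · refine Subtype.ext (Equiv.ext fun g => ?_)
    have := (rightRegular a b c h hgen).aut_comm σ (exists_mem_closure_mulRight hgen g) 1
    refine this.trans ?_
    change σ.1 (1 * g) = σ.1 g
    rw [one_mul]

omit [Finite G] in
theorem orderOf_mulRight (g : G) : orderOf (Equiv.mulRight g) = orderOf g := by
  have key : ∀ n : ℕ, Equiv.mulRight g ^ n = 1 ↔ g ^ n = 1 := by
    intro n
    rw [Equiv.pow_mulRight]
    refine ⟨fun hn => ?_, fun hn => by rw [hn, Equiv.mulRight_one]⟩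
    simpa using Equiv.congr_fun hn 1
  exact Nat.dvd_antisymm (orderOf_dvd_of_pow_eq_one ((key _).mpr (pow_orderOf_eq_one g)))
    (orderOf_dvd_of_pow_eq_one ((key _).mp (pow_orderOf_eq_one _)))

theorem rightRegular_hasType :
    (rightRegular a b c h hgen).HasType (orderOf a) (orderOf b) (orderOf c) :=
  ⟨orderOf_mulRight a, orderOf_mulRight b, orderOf_mulRight c⟩

end RightRegular

end Dessin

/-! ### Generating SL₂, and a Hurwitz triple in PSL₂(13) -/

section SpecialLinear

variable {F : Type*} [Field F]

open Matrix.ProjectiveSpecialLinearGroup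

/-- Upper unipotent matrices. -/
def upperUnipotent (t : F) : SL(2, F) := ⟨!![1, t; 0, 1], by simp⟩

theorem coe_upperUnipotent (t : F) :
    (upperUnipotent t : Matrix (Fin 2) (Fin 2) F) = !![1, t; 0, 1] := rfl

/-- Lower unipotent matrices. -/
def lowerUnipotent (t : F) : SL(2, F) := ⟨!![1, 0; t, 1], by simp⟩

theorem coe_lowerUnipotent (t : F) :
    (lowerUnipotent t : Matrix (Fin 2) (Fin 2) F) = !![1, 0; t, 1] := rfl

/-- A subgroup of `SL₂` containing the upper unipotent group and the Weyl element is everything. -/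
theorem SL2_eq_top_of_mem {K : Subgroup SL(2, F)} (hU : ∀ t : F, upperUnipotent t ∈ K)
    (hw : weyl F ∈ K) : K = ⊤ := by
  have hL : ∀ t : F, lowerUnipotent t ∈ K := by
    intro t
    have h : lowerUnipotent t = weyl F * upperUnipotent (-t) * (weyl F)⁻¹ := by
      rw [eq_mul_inv_iff_mul_eq]
      refine Subtype.ext ?_
      rw [Matrix.SpecialLinearGroup.coe_mul, Matrix.SpecialLinearGroup.coe_mul, coe_weyl,
        coe_upperUnipotent, coe_lowerUnipotent]
      simp
    rw [h]
    exact mul_mem (mul_mem hw (hU (-t))) (inv_mem hw)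
  have hne : ∀ A : SL(2, F), A 1 0 ≠ 0 → A ∈ K := by
    intro A hA
    have hd := A.det_coe
    rw [Matrix.det_fin_two] at hd
    have h : A = upperUnipotent ((A 0 0 - 1) / A 1 0) * lowerUnipotent (A 1 0) *
        upperUnipotent ((A 1 1 - 1) / A 1 0) := by
      refine Subtype.ext ?_
      rw [Matrix.SpecialLinearGroup.coe_mul, Matrix.SpecialLinearGroup.coe_mul,
        coe_upperUnipotent, coe_upperUnipotent, coe_lowerUnipotent]
      ext i j
      fin_cases i <;> fin_cases j <;> simp [Matrix.mul_apply, hA]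
      · field_simp
        linear_combination -hd
      · rw [mul_div_cancel₀ _ hA, sub_add_cancel]
    rw [h]
    exact mul_mem (mul_mem (hU _) (hL _)) (hU _)
  rw [Subgroup.eq_top_iff']
  intro A
  by_cases hA : A 1 0 = 0
  -- The Weyl element moves A 0 0, here a unit, up to sign into the lower left corner.
  · rw [← Subgroup.mul_mem_cancel_left K hw]
    apply hne
    have hd := A.det_coe
    rw [Matrix.det_fin_two, hA, mul_zero, sub_zero] at hd
    rw [Matrix.SpecialLinearGroup.coe_mul, coe_weyl]
    simpa [Matrix.mul_apply] using left_ne_zero_of_mul_eq_one hd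
  · exact hne A hA

instance fact_prime_thirteen : Fact (Nat.Prime 13) := ⟨by norm_num⟩

namespace PSL13

/-- A preimage in `SL₂(13)` of the generator of order three. -/
def X : SL(2, ZMod 13) := ⟨!![1, 4; 9, 11], by decide⟩

/-- A preimage in `SL₂(13)` of the generator of order two. -/
def Y : SL(2, ZMod 13) := weyl (ZMod 13)

theorem neg_one_mem_center : (-1 : SL(2, ZMod 13)) ∈ Subgroup.center SL(2, ZMod 13) :=
  Subgroup.mem_center_iff.mpr fun g => by simp

/-- A word in X and Y is, up to sign, a nontrivial transvection, whose powers exhaust the upper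
unipotent group because 13 is prime. -/
theorem closure_eq_top (K : Subgroup SL(2, ZMod 13)) (hX : X ∈ K) (hY : Y ∈ K)
    (hZ : -1 ∈ K) : K = ⊤ := by
  refine SL2_eq_top_of_mem (fun t => ?_) hY
  have h3 : upperUnipotent 3 ∈ K := by
    have : upperUnipotent 3 = -1 * (X * X * Y * (X * Y) * (X * X * Y)) := by decide
    rw [this]
    have hXX := mul_mem (mul_mem hX hX) hY
    exact mul_mem hZ (mul_mem (mul_mem hXX (mul_mem hX hY)) hXX)
  have hn : ∀ n : ℕ, upperUnipotent (3 * (n : ZMod 13)) ∈ K := by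
    intro n
    have h : upperUnipotent (3 * (n : ZMod 13)) = upperUnipotent 3 ^ n := by
      induction n with
      | zero => exact Subtype.ext (by simp [coe_upperUnipotent, Matrix.one_fin_two])
      | succ n ih =>
        rw [pow_succ, ← ih]
        refine Subtype.ext ?_
        rw [Matrix.SpecialLinearGroup.coe_mul]
        simp only [coe_upperUnipotent]
        ext i j
        fin_cases i <;> fin_cases j <;> simp [Matrix.mul_apply]
        ring
    rw [h]
    exact pow_mem h3 n
  -- 9 is the inverse of 3 modulo 13.
  have ht : 3 * (((9 * t).val : ℕ) : ZMod 13) = t := by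
    rw [ZMod.natCast_zmod_val, ← mul_assoc, show (3 * 9 : ZMod 13) = 1 by decide, one_mul]
  simpa only [ht] using hn (9 * t).val

/-- The generator of order three. -/
def x : PSL(2, ZMod 13) := QuotientGroup.mk X

/-- The generator of order two. -/
def y : PSL(2, ZMod 13) := QuotientGroup.mk Y

theorem neg_one_eq : (QuotientGroup.mk (-1 : SL(2, ZMod 13)) : PSL(2, ZMod 13)) = 1 :=
  (QuotientGroup.eq_one_iff _).mpr neg_one_mem_center

/-- Reduces nontriviality in the quotient to a decidable test: failing to commute with one matrix.
-/
theorem mk_ne_one {A : SL(2, ZMod 13)} (hA : Y * A ≠ A * Y ∨ X * A ≠ A * X) :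
    (QuotientGroup.mk A : PSL(2, ZMod 13)) ≠ 1 := by
  rw [Ne, QuotientGroup.eq_one_iff]
  intro h
  rcases hA with hA | hA
  · exact hA (Subgroup.mem_center_iff.mp h Y)
  · exact hA (Subgroup.mem_center_iff.mp h X)

theorem orderOf_x : orderOf x = 3 := by
  refine orderOf_eq_prime ?_ (mk_ne_one (Or.inl (by decide)))
  rw [x, ← QuotientGroup.mk_pow, show X ^ 3 = 1 by decide]
  rfl

theorem orderOf_y : orderOf y = 2 := by
  refine orderOf_eq_prime ?_ (mk_ne_one (Or.inr (by decide)))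
  rw [y, ← QuotientGroup.mk_pow, show Y ^ 2 = -1 by decide, neg_one_eq]

theorem orderOf_y_mul_x : orderOf (y * x) = 7 := by
  have : Fact (Nat.Prime 7) := ⟨by norm_num⟩
  rw [x, y, ← QuotientGroup.mk_mul]
  refine orderOf_eq_prime ?_ (mk_ne_one (Or.inl (by decide)))
  rw [← QuotientGroup.mk_pow, show (Y * X) ^ 7 = -1 by decide, neg_one_eq]

theorem closure_generators : Subgroup.closure ({x, y, (y * x)⁻¹} : Set PSL(2, ZMod 13)) = ⊤ := by
  have h : (Subgroup.closure ({x, y, (y * x)⁻¹} : Set PSL(2, ZMod 13))).comap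
      (QuotientGroup.mk' _) = ⊤ := by
    apply closure_eq_top
    · exact Subgroup.subset_closure (Or.inl rfl)
    · exact Subgroup.subset_closure (Or.inr (Or.inl rfl))
    · rw [Subgroup.mem_comap, QuotientGroup.mk'_apply, neg_one_eq]
      exact one_mem _
  rw [Subgroup.eq_top_iff']
  intro g
  obtain ⟨A, rfl⟩ := QuotientGroup.mk_surjective g
  have hA : A ∈ (Subgroup.closure ({x, y, (y * x)⁻¹} : Set PSL(2, ZMod 13))).comap
      (QuotientGroup.mk' _) := h ▸ Subgroup.mem_top A
  exact hA

end PSL13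

theorem exists_hurwitz_PSL13 : ∃ (E : Type) (R : Dessin E), R.IsHurwitz ∧
    Nonempty (R.Aut ≃* Matrix.ProjectiveSpecialLinearGroup (Fin 2) (ZMod 13)) := by
  have : Finite SL(2, ZMod 13) := Subtype.finite
  have h : (PSL13.y * PSL13.x)⁻¹ * PSL13.y * PSL13.x = 1 := by
    rw [mul_assoc, inv_mul_cancel]
  refine ⟨PSL(2, ZMod 13), Dessin.rightRegular _ _ _ h PSL13.closure_generators,
    ⟨Dessin.rightRegular_isRegular _ _, ?_⟩, Dessin.nonempty_aut_rightRegular_mulEquiv _ _⟩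
  have := Dessin.rightRegular_hasType h PSL13.closure_generators
  rwa [PSL13.orderOf_x, PSL13.orderOf_y, orderOf_inv, PSL13.orderOf_y_mul_x] at this

end SpecialLinear

/-! ### Transport to the automorphism group, and group orders -/

theorem IsDihedralOfOrder.of_mulEquiv {G G' : Type*} [Group G] [Group G'] {H : Subgroup G}
    {H' : Subgroup G'} {k : ℕ} (h : IsDihedralOfOrder H k) (e : H' ≃* H) :
    IsDihedralOfOrder H' k :=
  ⟨(Nat.card_congr e.toEquiv).trans h.1, h.2.imp fun _ ⟨f⟩ => ⟨e.trans f⟩⟩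

theorem IsProjectiveLineAction.compHom {G G' X : Type*} [Group G] [Group G'] [MulAction G' X]
    [DecidableEq X] {q : ℕ} (h : IsProjectiveLineAction G' X q) (e : G ≃* G') :
    @IsProjectiveLineAction G X _ (MulAction.compHom X e.toMonoidHom) _ q := by
  let : MulAction G X := MulAction.compHom X e.toMonoidHom
  refine ⟨h.card, fun g a b c hab hac hbc ha hb hc => ?_, ?_, ?_⟩
  · exact (map_eq_one_iff e e.injective).mp (h.fixes (e g) a b c hab hac hbc ha hb hc)
  · rw [MulAction.is_two_pretransitive_iff]
    intro a b c d hab hcd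
    obtain ⟨g, h1, h2⟩ := MulAction.is_two_pretransitive_iff.mp h.transitive hab hcd
    obtain ⟨g, rfl⟩ := e.surjective g
    exact ⟨g, h1, h2⟩
  · obtain ⟨t, ht⟩ := h.dihedral
    have hmap : (MulAction.stabilizer G t).map e.toMonoidHom = MulAction.stabilizer G' t := by
      ext g
      obtain ⟨g, rfl⟩ := e.surjective g
      constructor
      · rintro ⟨g', hg', hgg⟩
        rw [← hgg]
        exact hg'
      · exact fun hg => ⟨g, hg, rfl⟩
    exact ⟨t, ht.of_mulEquiv
      ((e.subgroupMap (MulAction.stabilizer G t)).trans (MulEquiv.subgroupCongr hmap))⟩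

theorem Matrix.ProjectiveSpecialLinearGroup.isProjectiveLineAction {F : Type*} [Field F] [Finite F]
    [DecidableEq (ℙ F (Fin 2 → F))] (h2 : (2 : F) ≠ 0) :
    IsProjectiveLineAction PSL(2, F) (ℙ F (Fin 2 → F)) (Nat.card F) :=
  ⟨card_projectivization, fixesAtMostTwo, isMultiplyPretransitive,
    exists_isDihedralOfOrder_stabilizer h2⟩

namespace IsProjectiveLineAction

variable {G X : Type*} [Group G] [MulAction G X] [DecidableEq X] {u : ℕ}

theorem card_pairs_of_odd (h : IsProjectiveLineAction G X (2 * u + 1)) :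
    Nat.card (Set.powersetCard X 2) = (2 * u + 1) * (u + 1) := by
  rw [h.card_pairs, Nat.choose_two_right]
  refine Nat.div_eq_of_eq_mul_left two_pos ?_
  rw [Nat.add_sub_cancel]
  ring

theorem card_group_of_odd (h : IsProjectiveLineAction G X (2 * u + 1)) :
    Nat.card G = (2 * u + 1) * ((u + 1) * (2 * u)) := by
  rw [h.card_group, ← h.card_pairs, h.card_pairs_of_odd, Nat.add_sub_cancel]
  ring

/-- Of the factors q, (q + 1)/2 and q - 1 of |G|, the prime p divides only q. -/
theorem card_sylow {p n : ℕ} [Fact p.Prime] [Finite G]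
    (h : IsProjectiveLineAction G X (2 * u + 1)) (hu : u ≠ 0) (hn : 2 * u + 1 = p ^ n)
    (P : Sylow p G) : Nat.card P = 2 * u + 1 := by
  have hp : p.Prime := Fact.out
  have hn0 : n ≠ 0 := by
    rintro rfl
    rw [pow_zero] at hn
    omega
  have hpq : p ∣ 2 * u + 1 := hn ▸ dvd_pow_self p hn0
  have hpu : ¬ p ∣ (u + 1) * (2 * u) := by
    rw [hp.dvd_mul]
    rintro (hd | hd)
    · have : p ∣ 1 := by
        refine (Nat.dvd_add_right hpq).mp ?_
        rw [show 2 * u + 1 + 1 = 2 * (u + 1) by ring]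
        exact hd.mul_left 2
      exact hp.one_lt.ne' (Nat.dvd_one.mp this)
    · exact hp.one_lt.ne' (Nat.dvd_one.mp ((Nat.dvd_add_right hd).mp hpq))
  rw [Sylow.card_eq_multiplicity, h.card_group_of_odd, hn,
    Nat.factorization_mul (pow_ne_zero _ hp.ne_zero) (by positivity), Finsupp.add_apply,
    hp.factorization_pow, Finsupp.single_eq_same, Nat.factorization_eq_zero_of_not_dvd hpu,
    add_zero]

end IsProjectiveLineAction

/-! ### Genera of the two quotients -/

namespace Dessin

variable {E : Type*}

theorem isFaithfulQuotient_of_isSimpleGroup (D : Dessin E) [IsSimpleGroup D.Aut]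
    {H : Subgroup D.Aut} (hH : H ≠ ⊤) : D.IsFaithfulQuotient H :=
  (H.normalCore_normal.eq_bot_or_eq_top).resolve_right fun h =>
    hH (top_le_iff.mp (h ▸ H.normalCore_le))

theorem IsHurwitz.three_mul_numCycles_quotient {D : Dessin E} (hD : D.IsHurwitz)
    (H : Subgroup D.Aut) :
    3 * numCycles (D.quotient H).x = (D.quotient H).degree +
      2 * Nat.card {w // D.quotientPerm H D.x D.x_mem w = w} :=
  have := (D.quotient H).finite
  prime_mul_numCycles Nat.prime_three
    (D.quotientPerm_pow_eq_one H D.x_mem (by rw [← hD.2.1, pow_orderOf_eq_one]))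

theorem IsHurwitz.two_mul_numCycles_quotient {D : Dessin E} (hD : D.IsHurwitz)
    (H : Subgroup D.Aut) :
    2 * numCycles (D.quotient H).y = (D.quotient H).degree +
      Nat.card {w // D.quotientPerm H D.y D.y_mem w = w} := by
  have := (D.quotient H).finite
  have h := prime_mul_numCycles Nat.prime_two
    (D.quotientPerm_pow_eq_one H D.y_mem (by rw [← hD.2.2.1, pow_orderOf_eq_one]))
  rwa [show 2 - 1 = 1 from rfl, one_mul] at h

theorem IsHurwitz.seven_mul_numCycles_quotient {D : Dessin E} (hD : D.IsHurwitz)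
    (H : Subgroup D.Aut) :
    7 * numCycles (D.quotient H).z = (D.quotient H).degree +
      6 * Nat.card {w // D.quotientPerm H D.z D.z_mem w = w} :=
  have := (D.quotient H).finite
  prime_mul_numCycles (by norm_num)
    (D.quotientPerm_pow_eq_one H D.z_mem (by rw [← hD.2.2.2, pow_orderOf_eq_one]))

/-- If the order of `H` is prime to `42` then `x`, `y`, `z` have no fixed edges in the quotient by
`H`, which determines its genus. -/
theorem IsHurwitz.hasGenus_quotient_of_coprime {D : Dessin E} (hD : D.IsHurwitz)
    {H : Subgroup D.Aut} (hH : (Nat.card H).Coprime 42) {k : ℕ}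
    (hk : (D.quotient H).degree = 84 * k) : (D.quotient H).HasGenus (k + 1) := by
  have key : ∀ (σ : Equiv.Perm E) (hσ : σ ∈ D.monodromy), orderOf σ ≠ 1 → orderOf σ ∣ 42 →
      Nat.card {w // D.quotientPerm H σ hσ w = w} = 0 := by
    intro σ hσ h1 h42
    have : IsEmpty {w // D.quotientPerm H σ hσ w = w} :=
      ⟨fun w => hD.1.quotientPerm_apply_ne H hσ (fun h => h1 (orderOf_eq_one_iff.mpr h))
        (hH.coprime_dvd_right h42).symm w.1 w.2⟩
    exact Nat.card_of_isEmpty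
  have hx := hD.three_mul_numCycles_quotient H
  have hy := hD.two_mul_numCycles_quotient H
  have hz := hD.seven_mul_numCycles_quotient H
  obtain ⟨ox, oy, oz⟩ := hD.2
  rw [key _ _ (by omega) (by rw [ox]; norm_num)] at hx
  rw [key _ _ (by omega) (by rw [oy]; norm_num)] at hy
  rw [key _ _ (by omega) (by rw [oz]; norm_num)] at hz
  -- The Euler characteristic is n(1/3 + 1/2 + 1/7 - 1) = -n/42 = -2k.
  rw [HasGenus, eulerChar]
  push_cast
  omega

theorem IsHurwitz.exists_hasGenus_quotient_stabilizer {D : Dessin E} (hD : D.IsHurwitz)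
    {X : Type*} [MulAction D.Aut X] [DecidableEq X] {u k : ℕ}
    (h : IsProjectiveLineAction D.Aut X (2 * u + 1)) (hk : u * (u + 1) = 42 * k)
    (t : Set.powersetCard X 2) :
    (D.quotient (MulAction.stabilizer D.Aut t)).degree = (2 * u + 1) * (u + 1) ∧
    ∃ g : ℕ, (D.quotient (MulAction.stabilizer D.Aut t)).HasGenus g ∧
      168 * g + 40 * u ≤ 168 * k + 128 := by
  have := h.isPretransitive
  have : Finite X := Nat.finite_of_card_ne_zero (by rw [h.card]; omega)
  obtain ⟨⟨e⟩, hfix⟩ := hD.1.exists_equiv t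
  have hdeg : (D.quotient (MulAction.stabilizer D.Aut t)).degree = (2 * u + 1) * (u + 1) :=
    (Nat.card_congr e).trans h.card_pairs_of_odd
  refine ⟨hdeg, ?_⟩
  have hx := hD.three_mul_numCycles_quotient (MulAction.stabilizer D.Aut t)
  have hy := hD.two_mul_numCycles_quotient (MulAction.stabilizer D.Aut t)
  have hz := hD.seven_mul_numCycles_quotient (MulAction.stabilizer D.Aut t)
  obtain ⟨ox, oy, oz⟩ := hD.2
  obtain ⟨a, oa, ha⟩ := hfix D.x D.x_mem
  obtain ⟨b, ob, hb⟩ := hfix D.y D.y_mem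
  obtain ⟨c, oc, hc⟩ := hfix D.z D.z_mem
  have ha1 := h.fixes.card_fixed_pairs_le_one (a := a) (by rintro rfl; simp at oa; omega)
    (by rw [oa, ox]; decide)
  have hc1 := h.fixes.card_fixed_pairs_le_one (a := c) (by rintro rfl; simp at oc; omega)
    (by rw [oc, oz]; decide)
  have hb1 := h.fixes.two_mul_card_fixed_pairs (a := b) (by rw [ob, oy])
    (by rw [h.card]; exact ⟨u + 1, by ring⟩)
  rw [← ha] at ha1
  rw [← hc] at hc1
  rw [← hb, h.card] at hb1
  have hdeg' : (D.quotient (MulAction.stabilizer D.Aut t)).degree = 84 * k + u + 1 := by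
    rw [hdeg]
    linarith
  -- Since 4(u² - 9u + 21) = (2u - 9)² + 3. This gives cx + cz ≤ 42k + 3; as cx + cz is even, it is
  -- at most 42k + 2, so the subtraction in the witness below does not truncate.
  have hu : 10 * u ≤ 42 * k + 21 := by
    zify at hk ⊢
    nlinarith [sq_nonneg (2 * (u : ℤ) - 9)]
  simp only [HasGenus, eulerChar]
  generalize numCycles (D.quotient (MulAction.stabilizer D.Aut t)).x = cx at *
  generalize numCycles (D.quotient (MulAction.stabilizer D.Aut t)).y = cy at *
  generalize numCycles (D.quotient (MulAction.stabilizer D.Aut t)).z = cz at *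
  clear ha hb hc hfix
  -- Here cy = 42k + u + 1, so the Euler characteristic is cx + cz - 42k. The bound on the genus is
  -- the case where x and z fix no pair.
  refine ⟨(42 * k + 2 - (cx + cz)) / 2, ?_, ?_⟩ <;> omega

end Dessin

/-! ### Arithmetic of q and the main theorem -/

theorem exists_mul_succ_eq_of_dvd {u : ℕ} (h3 : ¬ 3 ∣ 2 * u + 1) (h7 : ¬ 7 ∣ 2 * u + 1)
    (h7' : 7 ∣ (2 * u + 1) * ((u + 1) * (2 * u))) : ∃ k, u * (u + 1) = 42 * k := by
  have d2 : 2 ∣ u * (u + 1) := (Nat.even_mul_succ_self u).two_dvd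
  have d3 : 3 ∣ u * (u + 1) := by
    have : u % 3 = 0 ∨ (u + 1) % 3 = 0 := by
      clear h7 h7' d2
      rcases (by omega : u % 3 = 0 ∨ u % 3 = 1 ∨ u % 3 = 2) with h | h | h <;> omega
    rcases this with h | h
    · exact (Nat.dvd_of_mod_eq_zero h).mul_right _
    · exact (Nat.dvd_of_mod_eq_zero h).mul_left _
  have d7 : 7 ∣ u * (u + 1) := by
    have hp : Nat.Prime 7 := by norm_num
    have h := (hp.dvd_mul.mp h7').resolve_left h7
    rcases hp.dvd_mul.mp h with h | h
    · exact h.mul_left _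
    · exact ((hp.dvd_mul.mp h).resolve_left (by norm_num)).mul_right _
  generalize u * (u + 1) = n at d2 d3 d7
  exact (by omega : 42 ∣ n)

theorem mainTheorem3 :
    (∀ (F : Type*) [Field F] [Finite F] (p q : ℕ) [Fact p.Prime] [CharP F p],
      Nat.card F = q → Nat.Coprime q 42 →
      ∀ (E : Type*) (R : Dessin E), R.IsHurwitz →
        Nonempty (R.Aut ≃* Matrix.ProjectiveSpecialLinearGroup (Fin 2) F) →
        -- dihedral subgroups of order `q - 1` exist and are all conjugate
        (∃ H' : Subgroup R.Aut, IsDihedralOfOrder H' (q - 1)) ∧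
        (∀ H₁ H₂ : Subgroup R.Aut, IsDihedralOfOrder H₁ (q - 1) → IsDihedralOfOrder H₂ (q - 1) →
          ∃ a : R.Aut, H₁.map (MulAut.conj a).toMonoidHom = H₂) ∧
        -- comparison of the two quotients
        ∀ (H : Sylow p R.Aut) (H' : Subgroup R.Aut), IsDihedralOfOrder H' (q - 1) →
          R.IsFaithfulQuotient (H : Subgroup R.Aut) ∧ R.IsFaithfulQuotient H' ∧
          ((R.quotient (H : Subgroup R.Aut)).degree : ℚ) = ((q : ℚ) ^ 2 - 1) / 2 ∧
          ((R.quotient H').degree : ℚ) = (q : ℚ) * (q + 1) / 2 ∧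
          (R.quotient (H : Subgroup R.Aut)).degree < (R.quotient H').degree ∧
          ∃ g g' : ℕ, (R.quotient (H : Subgroup R.Aut)).HasGenus g ∧
            (R.quotient H').HasGenus g' ∧
            (g : ℚ) = ((q : ℚ) ^ 2 + 167) / 168 ∧
            (g' : ℚ) ≤ ((q : ℚ) ^ 2 - 20 * q + 147) / 168 ∧
            ((q : ℚ) ^ 2 - 20 * q + 147) / 168 < ((q : ℚ) ^ 2 + 167) / 168 ∧
            g' < g ∧
            (q = 13 → (R.quotient (H : Subgroup R.Aut)).degree = 84 ∧
              (R.quotient H').degree = 91 ∧ g = 2 ∧ g' = 0)) ∧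
    -- the case `q = 13` does occur
    (∃ (E : Type) (R : Dessin E), R.IsHurwitz ∧
      Nonempty (R.Aut ≃* Matrix.ProjectiveSpecialLinearGroup (Fin 2) (ZMod 13))) := by
  refine ⟨?_, exists_hurwitz_PSL13⟩
  intro F _ _ p q _ _ hq hco E R hR ⟨e⟩
  classical
  have hp : p.Prime := Fact.out
  have h2 : ¬ 2 ∣ q := fun h => by
    have := Nat.dvd_gcd h (by norm_num : 2 ∣ 42)
    rw [hco.gcd_eq_one] at this
    omega
  have h3 : ¬ 3 ∣ q := fun h => by
    have := Nat.dvd_gcd h (by norm_num : 3 ∣ 42)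
    rw [hco.gcd_eq_one] at this
    omega
  have h7 : ¬ 7 ∣ q := fun h => by
    have := Nat.dvd_gcd h (by norm_num : 7 ∣ 42)
    rw [hco.gcd_eq_one] at this
    omega
  obtain ⟨n, hn⟩ : ∃ n : ℕ, q = p ^ n := by
    have := Fintype.ofFinite F
    obtain ⟨n, -, hn⟩ := FiniteField.card F p
    exact ⟨n, by rw [← hq, Nat.card_eq_fintype_card, hn]⟩
  have hF2 : (2 : F) ≠ 0 := by
    intro h
    have hp2 : p ∣ 2 := (CharP.cast_eq_zero_iff F p 2).mp (by exact_mod_cast h)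
    have hp2' : p = 2 := (Nat.prime_dvd_prime_iff_eq hp Nat.prime_two).mp hp2
    have hn0 : n ≠ 0 := by
      rintro rfl
      have := Finite.one_lt_card (α := F)
      rw [hq, hn] at this
      simp at this
    exact h2 (hn ▸ hp2' ▸ dvd_pow_self p hn0)
  let _ : MulAction R.Aut (ℙ F (Fin 2 → F)) := MulAction.compHom _ e.toMonoidHom
  have hPL : IsProjectiveLineAction R.Aut (ℙ F (Fin 2 → F)) q :=
    hq ▸ (Matrix.ProjectiveSpecialLinearGroup.isProjectiveLineAction hF2).compHom e
  have hq1 : 1 < q := hq ▸ Finite.one_lt_card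
  have := R.finite
  have : Finite R.Aut := Subtype.finite
  obtain ⟨u, hu⟩ : ∃ u, q = 2 * u + 1 := ⟨q / 2, by omega⟩
  rw [hu] at hPL h3 h7 hn
  obtain ⟨t₀, ht₀⟩ := hPL.dihedral
  -- The face rotation z corresponds to an automorphism of order 7.
  have h7' : 7 ∣ (2 * u + 1) * ((u + 1) * (2 * u)) := by
    have := hPL.isPretransitive
    obtain ⟨a, ha, -⟩ := (hR.1.exists_equiv t₀).2 R.z R.z_mem
    rw [← hPL.card_group_of_odd, ← hR.2.2.2, ← ha]
    exact orderOf_dvd_natCard a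
  obtain ⟨k, hk⟩ := exists_mul_succ_eq_of_dvd h3 h7 h7'
  have hk0 : k ≠ 0 := by
    rintro rfl
    have : u * (u + 1) ≠ 0 := by
      have : u ≠ 0 := by omega
      positivity
    omega
  -- A positive multiple of 42 is at least 6 · 7; thus q ≥ 13, enough for simplicity and for the
  -- dihedral classification.
  have hu6 : 6 ≤ u := by
    by_contra! hlt
    have : u * (u + 1) ≤ 5 * 6 := Nat.mul_le_mul (by omega) (by omega)
    omega
  have hsimple : IsSimpleGroup R.Aut := by
    have := Matrix.ProjectiveSpecialLinearGroup.rank_two_simple (F := F) (by omega)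
    exact e.isSimpleGroup
  have hcard : Nat.card E = (2 * u + 1) * ((u + 1) * (2 * u)) := by
    rw [← hR.1.card_aut, hPL.card_group_of_odd]
  -- The quotient by the whole automorphism group has a single edge.
  have hne : ∀ H : Subgroup R.Aut, 1 < (R.quotient H).degree → H ≠ ⊤ := by
    rintro H hH rfl
    have h := R.mul_card_quotientEdges ⊤
    rw [← hR.1.card_aut, Subgroup.card_top] at h
    have hpos : 0 < Nat.card R.Aut := Nat.card_pos
    exact hH.ne' (Nat.eq_of_mul_eq_mul_right hpos (by rw [one_mul]; exact h.symm))
  rw [hu]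
  refine ⟨⟨_, ht₀⟩, fun H₁ H₂ h₁ h₂ => hPL.exists_map_conj_eq (by omega) h₁ h₂, ?_⟩
  intro H H' hH'
  have hHcard : Nat.card H = 2 * u + 1 := hPL.card_sylow (by omega) hn H
  have hdeg : (R.quotient (H : Subgroup R.Aut)).degree = 84 * k := by
    have h := R.mul_card_quotientEdges (H : Subgroup R.Aut)
    rw [hHcard, hcard, mul_comm] at h
    have h' := Nat.eq_of_mul_eq_mul_right (by omega) h
    change Nat.card (R.QuotientEdges (H : Subgroup R.Aut)) = _
    rw [← h']
    linarith
  have hgenus := hR.hasGenus_quotient_of_coprime (H := H) (by rw [hHcard, ← hu]; exact hco) hdeg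
  obtain ⟨t, rfl⟩ := hPL.exists_eq_stabilizer (by omega) hH'
  obtain ⟨hdeg', g', hg', hle⟩ := hR.exists_hasGenus_quotient_stabilizer hPL hk t
  have hkQ : (u : ℚ) * (u + 1) = 42 * k := by exact_mod_cast hk
  have hlt : (R.quotient (H : Subgroup R.Aut)).degree <
      (R.quotient (MulAction.stabilizer R.Aut t)).degree := by
    rw [hdeg, hdeg']
    linarith
  have hdegpos : 1 < (R.quotient (H : Subgroup R.Aut)).degree := by omega
  refine ⟨R.isFaithfulQuotient_of_isSimpleGroup (hne _ hdegpos),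
    R.isFaithfulQuotient_of_isSimpleGroup (hne _ (hdegpos.trans hlt)), ?_, ?_, hlt,
    k + 1, g', hgenus, hg', ?_, ?_, ?_, by omega, fun h13 => ?_⟩
  · rw [hdeg]
    push_cast
    linear_combination -2 * hkQ
  · rw [hdeg']
    push_cast
    ring
  · push_cast
    linear_combination -(1 / 42 : ℚ) * hkQ
  · have hleQ : 168 * (g' : ℚ) + 40 * u ≤ 168 * k + 128 := by exact_mod_cast hle
    push_cast
    linarith
  · have : (0 : ℚ) ≤ u := u.cast_nonneg
    push_cast
    linarith
  -- Then k = 1, and the bound reads 168 g' ≤ 56.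
  · obtain rfl : u = 6 := by omega
    rw [hdeg, hdeg']
    omega
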